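/- Let $n,k\ge 1$ be integers. A type distribution $\mathbf G$ for $n$ agents consists of a number $m$ of ranked types and numbers $G_{ij}$ ($i\in[n]$, $0\le j\le m$) with $0=G_{i0}\le G_{i1}\le\dots\le G_{im}=1$ for all $i$; $G_{ij}$ is the probability that agent $i$ has type $j$ or better. For $j\in[m]$ put $$Q_j^{\mathsf{Proph}}(\mathbf G)=\mathbb E\Big[\min\Big\{\sum_{i=1}^n\mathrm{Ber}(G_{ij}),k\Big\}\Big],\qquad Q_j^{\mathsf{ExAnte}}(\mathbf G)=\min\Big\{\sum_{i=1}^nG_{ij},k\Big\},$$ where the Bernoulli variables $\mathrm{Ber}(G_{1j}),\dots,\mathrm{Ber}(G_{nj})$ are independent. Let $\mathcal P_n^k$ be the set of pairs $(\mathbf x,\mathbf y)$ of real arrays $\mathbf x=(x_i^l)$, $\mathbf y=(y_i^l)$ ($i\in[n]$, $l\in[k]$) such that $0\le y_i^l\le x_i^l$ for all $i,l$, $x_1^k=1$, $x_1^l=0$ for $l<k$, and $x_i^l=x_{i-1}^l-y_{i-1}^l+y_{i-1}^{l+1}$ for $i>1$, with $y_{i}^{k+1}:=0$. For a static threshold $(J,\rho)\in[m]\times(0,1]$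 put $\tau_i(J,\rho)=(1-\rho)G_{i,J-1}+\rho G_{iJ}$. For a benchmark $\mathsf B\in\{\mathsf{Proph},\mathsf{ExAnte}\}$: (a) $\mathrm{innerLP}^{\mathsf{OST}(J,\rho)/\mathsf B}_{k,n}(\mathbf G)$ is the supremum of all $\theta\in\mathbb R$ for which there is $(\mathbf x,\mathbf y)\in\mathcal P_n^k$ with $y_i^l=\tau_i(J,\rho)\,x_i^l$ for all $i,l$ and $$\theta\, Q_j^{\mathsf B}(\mathbf G)\le\sum_{i=1}^n\sum_{l=1}^k\min\{y_i^l,G_{ij}x_i^l\}\qquad\text{for all }j\in[m];$$ (b) $\mathrm{innerLP}^{\mathsf{ST}/\mathsf B}_{k,n}(\mathbf G)$ is the supremum of all $\theta\in\mathbb R$ for which there are a Borel probability measure $\mu$ on $[m]\times(0,1]$ and, for each $(J,\rho)\in[m]\times(0,1]$, a pair $(\mathbf x(J,\rho),\mathbf y(J,\rho))\in\mathcal P_n^k$ with $y_i^l(J,\rho)=\tau_i(J,\rho)\,x_i^l(J,\rho)$ for all $i,l$, such that $$\theta\, Q_j^{\mathsf B}(\mathbf G)\le\int\sum_{i=1}^n\sum_{l=1}^k\min\{y_i^l(J,\rho),G_{ij}x_i^l(J,\rho)\}\,d\mu(J,\rho)\qquad\text{for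 all }j\in[m].$$ Theorem. For all integers $n,k\ge1$, $$\inf_{\mathbf G}\mathrm{innerLP}^{\mathsf{ST}/\mathsf{Proph}}_{k,n}(\mathbf G)=\inf_{\mathbf G}\mathrm{innerLP}^{\mathsf{ST}/\mathsf{ExAnte}}_{k,n}(\mathbf G)=\inf_{\mathbf G}\sup_{J,\rho}\mathrm{innerLP}^{\mathsf{OST}(J,\rho)/\mathsf{Proph}}_{k,n}(\mathbf G)=\inf_{\mathbf G}\sup_{J,\rho}\mathrm{innerLP}^{\mathsf{OST}(J,\rho)/\mathsf{ExAnte}}_{k,n}(\mathbf G),$$ where the infima range over all type distributions $\mathbf G$ for $n$ agents (with any number $m$ of types) and the suprema over $J\in[m]$, $\rho\in(0,1]$. -/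

import Mathlib

noncomputable section

namespace StaticThreshold

open MeasureTheory

/-- The type distributions `𝐆` of `n` agents over `m` ranked types (type `1` is the best).
For `j = 0, …, m`, the number `G i j` is the probability that agent `i` has type `j` or better,
so that `0 = G i 0 ≤ G i 1 ≤ … ≤ G i m = 1`.
A type `j ∈ {1, …, m}` is represented by `j : Fin m` (shifted by one), so that
`G i j.succ` stands for `G_{i,j}` and `G i j.castSucc` for `G_{i,j-1}`. -/
structure TypeDist (n : ℕ) where
  /-- the number of types -/
  m : ℕ
  /-- the cumulative type probabilities -/
  G : Fin n → Fin (m + 1) → ℝ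
  G_zero : ∀ i, G i 0 = 0
  G_mono : ∀ i, Monotone (G i)
  G_last : ∀ i, G i (Fin.last m) = 1

/-- `𝔼[f(∑ᵢ Ber(pᵢ))]` for independent Bernoulli variables with success probabilities
`p 0, …, p (n-1)`: the sum over the possible sets `S` of successes. -/
def bernoulliSumExp {n : ℕ} (p : Fin n → ℝ) (f : ℕ → ℝ) : ℝ :=
  ∑ S : Finset (Fin n), (∏ i ∈ S, p i) * (∏ i ∈ Sᶜ, (1 - p i)) * f S.card

/-- `Q_j` for the prophet: `𝔼[min{∑ᵢ Ber(G_{ij}), k}]`. -/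
def prophQ {n : ℕ} (k : ℕ) (D : TypeDist n) (j : Fin D.m) : ℝ :=
  bernoulliSumExp (fun i => D.G i j.succ) (fun s => min (s : ℝ) (k : ℝ))

/-- `Q_j` for the ex-ante relaxation: `min{∑ᵢ G_{ij}, k}`. -/
def exAnteQ {n : ℕ} (k : ℕ) (D : TypeDist n) (j : Fin D.m) : ℝ :=
  min (∑ i, D.G i j.succ) (k : ℝ)

/-- The set `𝒫ⁿₖ` of pairs `(𝐱, 𝐲)` satisfying the state-updating constraints.
The number of remaining slots `l ∈ {1, …, k}` is represented by `l : Fin k` (shifted by one),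
and `y i^{k+1}` is read as `0`. -/
def stateSet (n k : ℕ) : Set ((Fin n → Fin k → ℝ) × (Fin n → Fin k → ℝ)) :=
  {xy |
    (∀ i l, xy.2 i l ≤ xy.1 i l) ∧
    (∀ (i : Fin n) (l : Fin k), (i : ℕ) = 0 →
      xy.1 i l = if (l : ℕ) + 1 = k then 1 else 0) ∧
    (∀ (i : Fin n) (hi : (i : ℕ) + 1 < n) (l : Fin k),
      xy.1 ⟨i + 1, hi⟩ l =
        xy.1 i l - xy.2 i l + (if hl : (l : ℕ) + 1 < k then xy.2 i ⟨l + 1, hl⟩ else 0)) ∧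
    (∀ i l, 0 ≤ xy.2 i l)}

/-- The probability `(1-ρ) G_{i,J-1} + ρ G_{i,J}` that agent `i` clears the static threshold
with cutoff type `J` and tie-break probability `ρ`. -/
def TypeDist.clearProb {n : ℕ} (D : TypeDist n) (J : Fin D.m) (ρ : ℝ) (i : Fin n) : ℝ :=
  (1 - ρ) * D.G i J.castSucc + ρ * D.G i J.succ

/-- `∑ᵢ ∑ₗ min{yᵢˡ, G_{ij} xᵢˡ}`: the expected number of accepted agents of type `j` or
better. -/
def TypeDist.coverage {n k : ℕ} (D : TypeDist n) (x y : Fin n → Fin k → ℝ) (j : Fin D.m) : ℝ :=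
  ∑ i, ∑ l, min (y i l) (D.G i j.succ * x i l)

/-- Feasibility of `θ` for the simplified dual of the oblivious static threshold `(J, ρ)`, with
benchmark coefficients `Q`. -/
def FeasibleOST {n : ℕ} (k : ℕ) (D : TypeDist n) (Q : Fin D.m → ℝ) (J : Fin D.m) (ρ θ : ℝ) :
    Prop :=
  ∃ x y : Fin n → Fin k → ℝ,
    (x, y) ∈ stateSet n k ∧
    (∀ i l, y i l = D.clearProb J ρ i * x i l) ∧
    ∀ j, θ * Q j ≤ D.coverage x y j

/-- The value of the simplified dual for the oblivious static threshold `(J, ρ)`: the supremum,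
in the extended reals, of the objective `θ` over the feasible solutions. -/
def innerLPOST {n : ℕ} (k : ℕ) (D : TypeDist n) (Q : Fin D.m → ℝ) (J : Fin D.m) (ρ : ℝ) : EReal :=
  ⨆ (θ : ℝ) (_ : FeasibleOST k D Q J ρ θ), (θ : EReal)

/-- Feasibility of `θ` for the simplified dual of non-oblivious static thresholds, with benchmark
coefficients `Q`: here `μ` is a probability measure over the static thresholds
`(J, ρ) ∈ [m] × (0, 1]`, each of which has its own copy of the variables `𝐱, 𝐲`. -/
def FeasibleST {n : ℕ} (k : ℕ) (D : TypeDist n) (Q : Fin D.m → ℝ) (θ : ℝ) : Prop :=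
  ∃ (x y : Fin D.m × Set.Ioc (0 : ℝ) 1 → Fin n → Fin k → ℝ)
    (μ : Measure (Fin D.m × Set.Ioc (0 : ℝ) 1)),
    IsProbabilityMeasure μ ∧
    (∀ t, (x t, y t) ∈ stateSet n k) ∧
    (∀ t i l, y t i l = D.clearProb t.1 (t.2 : ℝ) i * x t i l) ∧
    ∀ j, θ * Q j ≤ ∫ t, D.coverage (x t) (y t) j ∂μ

/-- The value of the simplified dual for non-oblivious static thresholds. -/
def innerLPST {n : ℕ} (k : ℕ) (D : TypeDist n) (Q : Fin D.m → ℝ) : EReal :=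
  ⨆ (θ : ℝ) (_ : FeasibleST k D Q θ), (θ : EReal)

/-- `inf_𝐆 innerLP^{ST/Proph}_{k,n}(𝐆)` -/
def worstSTProph (k n : ℕ) : EReal :=
  ⨅ D : TypeDist n, innerLPST k D (prophQ k D)

/-- `inf_𝐆 innerLP^{ST/ExAnte}_{k,n}(𝐆)` -/
def worstSTExAnte (k n : ℕ) : EReal :=
  ⨅ D : TypeDist n, innerLPST k D (exAnteQ k D)

/-- `inf_𝐆 sup_{J,ρ} innerLP^{OST(J,ρ)/Proph}_{k,n}(𝐆)` -/
def worstOSTProph (k n : ℕ) : EReal :=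
  ⨅ D : TypeDist n, ⨆ (J : Fin D.m) (ρ : Set.Ioc (0 : ℝ) 1), innerLPOST k D (prophQ k D) J ρ

/-- `inf_𝐆 sup_{J,ρ} innerLP^{OST(J,ρ)/ExAnte}_{k,n}(𝐆)` -/
def worstOSTExAnte (k n : ℕ) : EReal :=
  ⨅ D : TypeDist n, ⨆ (J : Fin D.m) (ρ : Set.Ioc (0 : ℝ) 1), innerLPOST k D (exAnteQ k D) J ρ

end StaticThreshold

end

/-! The oblivious ex-ante value lies below the other three and the randomized prophet value lies
above them: `prophQ_le_exAnteQ` compares the benchmarks, and an oblivious threshold is a Dirac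
measure. It therefore suffices to find one number `V` that an oblivious threshold always guarantees
against ex-ante, and that no mixture of thresholds can beat against the prophet, up to `ε`, on some
instance (`exists_worstCase_value`).

If `n ≤ k`, slots never run out and `V = 1`. Otherwise let `N = n - 1`, choose `q` with
`𝔼[min(Bin(N,q),k)] = k · P(Bin(N,q) < k)`, and set `V = P(Bin(N,q) < k)`.

Guarantee: by continuity some threshold balances the same two quantities for the number `S` of
clearing agents among the first `N`. By `pbLt_const_le_or_pbMin_const_le`, constant probabilities
cannot be strictly better in both quantities, so `P(S < k) ≥ V`. Types strictly better than the
cutoff are then covered because every agent finds a free slot with probability at least `V`; the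
remaining types are covered because at least `kV` agents are accepted in expectation. The comparison
is an exchange argument resting on log-concavity.

Tightness: in `spikeDist` the first `N` agents are identical and the last one has the best type with
small probability `ε`. A threshold clearing the others with probability `r` earns at most `ε ·
P(Bin(N,r) < k)` on the best type and `𝔼[min(Bin(N,r),k)] + ε` overall. The curve of these two
binomial quantities lies below its tangent at `q` (`pbLt_pbMin_const_le_tangent`), so mixing
thresholds does not help. -/

namespace StaticThreshold

open Polynomial Finset

/-! ### Recursions and monotonicity for sums of independent Bernoulli variables -/

/-- `P(∑_{i ∈ s} Ber(pᵢ) = c)`, as a coefficient of the probability generating function. -/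
noncomputable def pb {ι : Type*} (p : ι → ℝ) (s : Finset ι) (c : ℕ) : ℝ :=
  (∏ i ∈ s, (C (1 - p i) + C (p i) * X)).coeff c

/-- `P(∑_{i ∈ s} Ber(pᵢ) < k)` -/
noncomputable def pbLt {ι : Type*} (p : ι → ℝ) (s : Finset ι) (k : ℕ) : ℝ :=
  ∑ c ∈ range k, pb p s c

/-- `𝔼[min(∑_{i ∈ s} Ber(pᵢ), k)]` -/
noncomputable def pbMin {ι : Type*} (p : ι → ℝ) (s : Finset ι) (k : ℕ) : ℝ :=
  ∑ c ∈ range k, (1 - pbLt p s (c + 1))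

section PoissonBinomial

variable {ι : Type*}

lemma pb_empty (p : ι → ℝ) (c : ℕ) : pb p ∅ c = if c = 0 then 1 else 0 := by
  simp [pb, coeff_one]

lemma pb_insert_zero [DecidableEq ι] (p : ι → ℝ) {s : Finset ι} {i : ι} (hi : i ∉ s) :
    pb p (insert i s) 0 = (1 - p i) * pb p s 0 := by
  simp [pb, prod_insert hi, mul_coeff_zero]

lemma pb_insert_succ [DecidableEq ι] (p : ι → ℝ) {s : Finset ι} {i : ι} (hi : i ∉ s) (c : ℕ) :
    pb p (insert i s) (c + 1) = (1 - p i) * pb p s (c + 1) + p i * pb p s c := by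
  simp only [pb, prod_insert hi, add_mul, coeff_add, coeff_C_mul, mul_assoc, coeff_X_mul]

lemma pb_congr {p p' : ι → ℝ} {s : Finset ι} (h : ∀ i ∈ s, p i = p' i) (c : ℕ) :
    pb p s c = pb p' s c := by
  unfold pb
  rw [prod_congr rfl fun i hi => by rw [h i hi]]

lemma pbLt_congr {p p' : ι → ℝ} {s : Finset ι} (h : ∀ i ∈ s, p i = p' i) (k : ℕ) :
    pbLt p s k = pbLt p' s k :=
  sum_congr rfl fun c _ => pb_congr h c

lemma pbMin_congr {p p' : ι → ℝ} {s : Finset ι} (h : ∀ i ∈ s, p i = p' i) (k : ℕ) :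
    pbMin p s k = pbMin p' s k :=
  sum_congr rfl fun c _ => by rw [pbLt_congr h]

lemma pbLt_zero (p : ι → ℝ) (s : Finset ι) : pbLt p s 0 = 0 := by simp [pbLt]

lemma pbLt_succ (p : ι → ℝ) (s : Finset ι) (k : ℕ) :
    pbLt p s (k + 1) = pbLt p s k + pb p s k := by simp [pbLt, sum_range_succ]

lemma pbMin_zero (p : ι → ℝ) (s : Finset ι) : pbMin p s 0 = 0 := by simp [pbMin]

lemma pbMin_succ (p : ι → ℝ) (s : Finset ι) (k : ℕ) :
    pbMin p s (k + 1) = pbMin p s k + (1 - pbLt p s (k + 1)) := sum_range_succ _ _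

lemma pbLt_empty_succ (p : ι → ℝ) (k : ℕ) : pbLt p ∅ (k + 1) = 1 := by
  simp [pbLt, pb_empty]

lemma pbMin_empty (p : ι → ℝ) (k : ℕ) : pbMin p ∅ k = 0 := by
  simp [pbMin, pbLt_empty_succ]

lemma pbLt_insert_succ [DecidableEq ι] (p : ι → ℝ) {s : Finset ι} {i : ι} (hi : i ∉ s) (k : ℕ) :
    pbLt p (insert i s) (k + 1) = pbLt p s (k + 1) - p i * pb p s k := by
  induction k with
  | zero => simp [pbLt, pb_insert_zero p hi]; ring
  | succ k ih => rw [pbLt_succ, ih, pb_insert_succ p hi, pbLt_succ p s (k + 1)]; ring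

/-- A further success raises the truncated count exactly when fewer than `k` occurred before. This
is the link between accepted agents and free slots. -/
lemma pbMin_insert [DecidableEq ι] (p : ι → ℝ) {s : Finset ι} {i : ι} (hi : i ∉ s) (k : ℕ) :
    pbMin p (insert i s) k = pbMin p s k + p i * pbLt p s k := by
  induction k with
  | zero => simp [pbMin, pbLt]
  | succ k ih => rw [pbMin_succ, pbMin_succ, ih, pbLt_insert_succ p hi, pbLt_succ p s k]; ring

lemma pb_nonneg {p : ι → ℝ} {s : Finset ι} (hp : ∀ i ∈ s, p i ∈ Set.Icc (0 : ℝ) 1) (c : ℕ) :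
    0 ≤ pb p s c := by
  classical
  induction s using Finset.induction_on generalizing c with
  | empty => rw [pb_empty]; split_ifs <;> norm_num
  | insert i s hi ih =>
    have h1 := hp i (mem_insert_self _ _)
    have h2 := ih fun j hj => hp j (mem_insert_of_mem hj)
    have h3 : 0 ≤ 1 - p i := by linarith [h1.2]
    cases c with
    | zero => rw [pb_insert_zero p hi]; exact mul_nonneg h3 (h2 _)
    | succ c =>
      rw [pb_insert_succ p hi]
      exact add_nonneg (mul_nonneg h3 (h2 _)) (mul_nonneg h1.1 (h2 _))

lemma pbLt_nonneg {p : ι → ℝ} {s : Finset ι} (hp : ∀ i ∈ s, p i ∈ Set.Icc (0 : ℝ) 1) (k : ℕ) :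
    0 ≤ pbLt p s k :=
  sum_nonneg fun c _ => pb_nonneg hp c

lemma pb_le_pbLt_succ {p : ι → ℝ} {s : Finset ι} (hp : ∀ i ∈ s, p i ∈ Set.Icc (0 : ℝ) 1)
    (k : ℕ) : pb p s k ≤ pbLt p s (k + 1) := by
  rw [pbLt_succ]; linarith [pbLt_nonneg hp k]

lemma pbLt_insert_le [DecidableEq ι] {p : ι → ℝ} {s : Finset ι} {i : ι} (hi : i ∉ s)
    (hp : ∀ j ∈ s, p j ∈ Set.Icc (0 : ℝ) 1) (h : 0 ≤ p i) (k : ℕ) :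
    pbLt p (insert i s) k ≤ pbLt p s k := by
  cases k with
  | zero => simp [pbLt_zero]
  | succ k => rw [pbLt_insert_succ p hi]; linarith [mul_nonneg h (pb_nonneg hp k)]

lemma pbLt_le_one {p : ι → ℝ} {s : Finset ι} (hp : ∀ i ∈ s, p i ∈ Set.Icc (0 : ℝ) 1) (k : ℕ) :
    pbLt p s k ≤ 1 := by
  classical
  induction s using Finset.induction_on with
  | empty =>
    cases k with
    | zero => simp [pbLt_zero]
    | succ k => rw [pbLt_empty_succ]
  | insert i s hi ih =>
    have h2 : ∀ j ∈ s, p j ∈ Set.Icc (0 : ℝ) 1 := fun j hj => hp j (mem_insert_of_mem hj)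
    exact (pbLt_insert_le hi h2 (hp i (mem_insert_self _ _)).1 k).trans (ih h2)

lemma pbLt_anti {p p' : ι → ℝ} {s : Finset ι} (hp : ∀ i ∈ s, 0 ≤ p i)
    (hp' : ∀ i ∈ s, p' i ≤ 1) (h : ∀ i ∈ s, p i ≤ p' i) (k : ℕ) : pbLt p' s k ≤ pbLt p s k := by
  classical
  induction s using Finset.induction_on generalizing k with
  | empty => exact (pbLt_congr (by simp) k).le
  | insert i s hi ih =>
    have hs : ∀ j ∈ s, p j ∈ Set.Icc (0 : ℝ) 1 := fun j hj =>
      ⟨hp j (mem_insert_of_mem hj), (h j (mem_insert_of_mem hj)).trans (hp' j (mem_insert_of_mem hj))⟩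
    cases k with
    | zero => simp [pbLt_zero]
    | succ k =>
      have ih' := ih (fun j hj => hp j (mem_insert_of_mem hj))
        (fun j hj => hp' j (mem_insert_of_mem hj)) (fun j hj => h j (mem_insert_of_mem hj))
      have e1 : ∀ r : ι → ℝ, pbLt r (insert i s) (k + 1) =
          (1 - r i) * pbLt r s (k + 1) + r i * pbLt r s k := fun r => by
        rw [pbLt_insert_succ r hi, pbLt_succ]; ring
      have hi1 := hp i (mem_insert_self _ _)
      have hi2 := hp' i (mem_insert_self _ _)
      have hi3 := h i (mem_insert_self _ _)
      rw [e1, e1]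
      have h1 := mul_le_mul_of_nonneg_left (ih' (k + 1)) (sub_nonneg.2 hi2)
      have h2 := mul_le_mul_of_nonneg_left (ih' k) (hi1.trans hi3)
      have h3 := mul_nonneg (sub_nonneg.2 hi3) (pb_nonneg hs k)
      rw [pbLt_succ p s k] at h1 ⊢
      nlinarith

lemma pbMin_mono {p p' : ι → ℝ} {s : Finset ι} (hp : ∀ i ∈ s, 0 ≤ p i)
    (hp' : ∀ i ∈ s, p' i ≤ 1) (h : ∀ i ∈ s, p i ≤ p' i) (k : ℕ) : pbMin p s k ≤ pbMin p' s k :=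
  sum_le_sum fun c _ => by linarith [pbLt_anti hp hp' h (c + 1)]

/-! ### Log-concavity and the exchange argument -/

/-- The distribution of a sum of independent Bernoulli variables is log-concave. -/
lemma pb_logConcave {p : ι → ℝ} {s : Finset ι} (hp : ∀ i ∈ s, p i ∈ Set.Icc (0 : ℝ) 1)
    {j c : ℕ} (hjc : j ≤ c) : pb p s j * pb p s (c + 1) ≤ pb p s (j + 1) * pb p s c := by
  classical
  induction s using Finset.induction_on generalizing j c with
  | empty => simp [pb_empty]
  | insert i s hi ih =>
    have h1 := hp i (mem_insert_self _ _)
    have hs : ∀ j ∈ s, p j ∈ Set.Icc (0 : ℝ) 1 := fun j hj => hp j (mem_insert_of_mem hj)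
    have h0 : 0 ≤ 1 - p i := by linarith [h1.2]
    -- The case `j = c` is trivial. Removing it leaves room to apply the two-index induction
    -- hypothesis twice to the mixed term `p i * (1 - p i)`, giving `a_j a_{c+2} ≤ a_{j+1} a_{c+1} ≤
    -- a_{j+2} a_c` in the shifted indices. The two-index form needs no division by possibly
    -- vanishing coefficients.
    rcases hjc.eq_or_lt with rfl | hlt
    · rw [mul_comm]
    obtain ⟨c, rfl⟩ : ∃ d, c = d + 1 := ⟨c - 1, by omega⟩
    have hjc' : j ≤ c := by omega
    have e1 := mul_nonneg (mul_nonneg h0 h0) (sub_nonneg.2 (ih hs hlt.le))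
    have e3 := ih hs hjc'
    cases j with
    | zero =>
      rw [pb_insert_zero p hi, pb_insert_succ p hi, pb_insert_succ p hi, pb_insert_succ p hi]
      have e2 := mul_nonneg (mul_nonneg h1.1 h1.1) (mul_nonneg (pb_nonneg hs 0) (pb_nonneg hs c))
      have e4 := mul_nonneg (mul_nonneg h1.1 h0) (mul_nonneg (pb_nonneg hs 1) (pb_nonneg hs c))
      simp only [zero_add] at *
      nlinarith
    | succ j =>
      rw [pb_insert_succ p hi, pb_insert_succ p hi, pb_insert_succ p hi, pb_insert_succ p hi]
      have e2 := mul_nonneg (mul_nonneg h1.1 h1.1) (sub_nonneg.2 (ih hs (j := j) (c := c) (by omega)))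
      have e5 := ih hs (j := j) (c := c + 1) (by omega)
      have e4 := mul_nonneg (mul_nonneg h1.1 h0) (sub_nonneg.2 (e5.trans e3))
      nlinarith

/-- Log-concavity summed over `j ≤ c`: shifting the index in the longer sum leaves only its
nonnegative zeroth term unmatched. -/
lemma pb_mul_pbLt_le {p : ι → ℝ} {s : Finset ι} (hp : ∀ i ∈ s, p i ∈ Set.Icc (0 : ℝ) 1) (c : ℕ) :
    pb p s (c + 1) * pbLt p s (c + 1) ≤ pb p s c * pbLt p s (c + 2) := by
  unfold pbLt
  rw [sum_range_succ' _ (c + 1), mul_add, mul_sum, mul_sum]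
  have : ∑ j ∈ range (c + 1), pb p s (c + 1) * pb p s j ≤
      ∑ j ∈ range (c + 1), pb p s c * pb p s (j + 1) := by
    refine sum_le_sum fun j hj => ?_
    have := pb_logConcave hp (j := j) (c := c) (by simp at hj; omega)
    linarith
  linarith [mul_nonneg (pb_nonneg hp c) (pb_nonneg hp 0)]

/-- The algebra of the exchange. Conditioned on the other variables, `𝔼[min(S,k)]` and `P(S < k)`
are affine in the sum and the product of the two probabilities. Keeping the first fixed ties the
change of the sum to that of the product, and `hlc`, supplied by log-concavity, then fixes the sign
of the change in the second. -/
lemma exists_exchange {F a a' q x z : ℝ} (ha : 0 ≤ a) (ha' : 0 ≤ a') (haF : a ≤ F) (ha'F : a' ≤ F)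
    (hlc : a * (F - a) ≤ a' * F) (hx : 0 ≤ x) (hxq : x < q) (hqz : q < z) (hz : z ≤ 1) :
    ∃ y, 0 ≤ y ∧ y ≤ 1 ∧ (q + y) * F - q * y * a = (x + z) * F - x * z * a ∧
      -(q + y) * a + q * y * (a - a') ≤ -(x + z) * a + x * z * (a - a') := by
  rcases (ha.trans haF).eq_or_lt with hF | hF
  · obtain rfl : a = 0 := by linarith
    obtain rfl : a' = 0 := by linarith
    subst hF
    exact ⟨0, by norm_num⟩
  have hd : 0 < F - q * a := by nlinarith
  -- The required equation is linear in `y`, and this is its solution.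
  set y := ((x + z) * F - x * z * a - q * F) / (F - q * a) with hy
  have hyd : y * (F - q * a) = (x + z) * F - x * z * a - q * F := div_mul_cancel₀ _ hd.ne'
  have heq : (q + y) * F - q * y * a = (x + z) * F - x * z * a := by linarith
  have hz' : 0 ≤ F - z * a := by nlinarith
  have hx' : 0 < F - x * a := by nlinarith
  have hxy : x ≤ y := by
    rw [hy, le_div_iff₀ hd]
    nlinarith [mul_nonneg (sub_nonneg.2 hqz.le) hx'.le]
  have hyz : y ≤ z := by
    rw [hy, div_le_iff₀ hd]
    nlinarith [mul_nonneg (sub_nonneg.2 hxq.le) hz']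
  refine ⟨y, hx.trans hxy, hyz.trans hz, heq, ?_⟩
  -- The difference of the two sides is `(q - x) * (y - x)`.
  have r1 : x * ((q + y) - (x + z)) ≤ q * y - x * z := by
    nlinarith [mul_nonneg (sub_nonneg.2 hxq.le) (sub_nonneg.2 hxy)]
  have hs : F * ((q + y) - (x + z)) = a * (q * y - x * z) := by linarith
  have s1 : 0 ≤ (q + y) - (x + z) := by
    have : 0 ≤ (F - x * a) * ((q + y) - (x + z)) := by nlinarith
    exact nonneg_of_mul_nonneg_right this hx'
  have hr : 0 ≤ q * y - x * z := (mul_nonneg hx s1).trans r1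
  have key : F * ((-(q + y) * a + q * y * (a - a')) - (-(x + z) * a + x * z * (a - a'))) ≤ 0 := by
    have : F * ((-(q + y) * a + q * y * (a - a')) - (-(x + z) * a + x * z * (a - a'))) =
        (q * y - x * z) * (a * (F - a) - a' * F) := by linear_combination (-a) * hs
    rw [this]
    exact mul_nonpos_of_nonneg_of_nonpos hr (by linarith)
  have := nonpos_of_mul_nonpos_right key hF
  linarith

/-- Two unequal success probabilities on both sides of `q` can be replaced, one of them by `q`,
without changing `𝔼[min(S, k)]` and without increasing `P(S < k)`. -/
lemma exists_exchange_pb [DecidableEq ι] {p : ι → ℝ} {s : Finset ι} {i j : ι} {q : ℝ} (hij : i ≠ j)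
    (hi : i ∈ s) (hj : j ∈ s)
    (hp : ∀ i ∈ s, p i ∈ Set.Icc (0 : ℝ) 1) (h1 : p i < q) (h2 : q < p j) (k : ℕ) :
    ∃ y, 0 ≤ y ∧ y ≤ 1 ∧
      pbMin (Function.update (Function.update p j y) i q) s k = pbMin p s k ∧
      pbLt (Function.update (Function.update p j y) i q) s k ≤ pbLt p s k := by
  set t := (s.erase i).erase j with ht
  have hjt : j ∉ t := by simp [ht]
  have hit : i ∉ insert j t := by simp [ht, hij]
  have hst : s = insert i (insert j t) := by
    rw [ht, insert_erase (mem_erase.2 ⟨hij.symm, hj⟩), insert_erase hi]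
  have hpt : ∀ i ∈ t, p i ∈ Set.Icc (0 : ℝ) 1 := fun l hl =>
    hp l (mem_of_mem_erase (mem_of_mem_erase hl))
  cases k with
  | zero => exact ⟨0, by simp [pbMin_zero, pbLt_zero]⟩
  | succ K =>
  -- Here `a'` stands for the probability of `K - 1` successes in `t`, which is `0` when `K = 0`;
  -- only the positive case uses log-concavity.
  obtain ⟨a', ha', ha'F, hlc, hins⟩ : ∃ a', 0 ≤ a' ∧ a' ≤ pbLt p t (K + 1) ∧
      pb p t K * (pbLt p t (K + 1) - pb p t K) ≤ a' * pbLt p t (K + 1) ∧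
      ∀ r : ι → ℝ, (∀ l ∈ t, r l = p l) →
        pb r (insert j t) K = (1 - r j) * pb p t K + r j * a' := by
    cases K with
    | zero =>
      refine ⟨0, le_rfl, pbLt_nonneg hpt _, by simp [pbLt], fun r hr => ?_⟩
      rw [pb_insert_zero r hjt, pb_congr hr]; ring
    | succ K =>
      refine ⟨pb p t K, pb_nonneg hpt _, ?_, ?_, fun r hr => ?_⟩
      · rw [pbLt_succ]; linarith [pb_le_pbLt_succ hpt K, pb_nonneg hpt (K + 1)]
      · have := pb_mul_pbLt_le hpt K
        rw [pbLt_succ p t (K + 1)] at this ⊢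
        linarith
      · rw [pb_insert_succ r hjt, pb_congr hr, pb_congr hr]
  obtain ⟨y, hy0, hy1, e1, e2⟩ := exists_exchange (pb_nonneg hpt K) ha' (pb_le_pbLt_succ hpt K)
    ha'F hlc (hp i hi).1 h1 h2 (hp j hj).2
  refine ⟨y, hy0, hy1, ?_⟩
  have hM : ∀ r : ι → ℝ, (∀ l ∈ t, r l = p l) → pbMin r s (K + 1) =
      pbMin p t (K + 1) + ((r i + r j) * pbLt p t (K + 1) - r i * r j * pb p t K) := by
    intro r hr
    rw [hst, pbMin_insert r hit, pbMin_insert r hjt, pbLt_insert_succ r hjt, pbMin_congr hr,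
      pbLt_congr hr, pb_congr hr]
    ring
  have hL : ∀ r : ι → ℝ, (∀ l ∈ t, r l = p l) → pbLt r s (K + 1) =
      pbLt p t (K + 1) + (-(r i + r j) * pb p t K + r i * r j * (pb p t K - a')) := by
    intro r hr
    rw [hst, pbLt_insert_succ r hit, pbLt_insert_succ r hjt, hins r hr, pbLt_congr hr, pb_congr hr]
    ring
  have hr : ∀ l ∈ t, Function.update (Function.update p j y) i q l = p l := by
    intro l hl
    have hli : l ≠ i := fun h => hit (mem_insert_of_mem (h ▸ hl))
    have hlj : l ≠ j := fun h => hjt (h ▸ hl)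
    simp [hli, hlj]
  rw [hM _ hr, hL _ hr, hM p fun _ _ => rfl, hL p fun _ _ => rfl]
  simp only [Function.update_self, Function.update_of_ne hij.symm]
  exact ⟨by rw [e1], by linarith⟩

/-- Compared with arbitrary success probabilities, constant ones cannot be better both for
`P(S < k)` and for `𝔼[min(S, k)]`. -/
theorem pbLt_const_le_or_pbMin_const_le {p : ι → ℝ} {s : Finset ι} {q : ℝ}
    (hq : q ∈ Set.Icc (0 : ℝ) 1) (hp : ∀ i ∈ s, p i ∈ Set.Icc (0 : ℝ) 1) (k : ℕ) :
    pbLt (fun _ => q) s k ≤ pbLt p s k ∨ pbMin (fun _ => q) s k ≤ pbMin p s k := by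
  classical
  -- Each exchange sets one more coordinate to `q`. Once all coordinates lie on one side of `q`,
  -- monotonicity settles one of the alternatives.
  induction hm : (s.filter fun i => p i ≠ q).card using Nat.strong_induction_on generalizing p with
  | _ m ih =>
  by_cases h1 : ∀ i ∈ s, p i ≤ q
  · exact Or.inl (pbLt_anti (fun i hi => (hp i hi).1) (fun _ _ => hq.2) h1 k)
  by_cases h2 : ∀ i ∈ s, q ≤ p i
  · exact Or.inr (pbMin_mono (fun _ _ => hq.1) (fun i hi => (hp i hi).2) h2 k)
  push Not at h1 h2
  obtain ⟨j, hj, hqj⟩ := h1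
  obtain ⟨i, hi, hiq⟩ := h2
  have hij : i ≠ j := by rintro rfl; linarith
  obtain ⟨y, hy0, hy1, e1, e2⟩ := exists_exchange_pb hij hi hj hp hiq hqj k
  have hlt : (s.filter fun l => Function.update (Function.update p j y) i q l ≠ q).card < m := by
    rw [← hm]
    refine card_lt_card ⟨fun l hl => ?_, fun h => ?_⟩
    · simp only [mem_filter] at hl ⊢
      refine ⟨hl.1, ?_⟩
      rcases eq_or_ne l i with rfl | hli
      · exact absurd (by simp) hl.2
      rcases eq_or_ne l j with rfl | hlj
      · exact hqj.ne'
      · simpa [hli, hlj] using hl.2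
    · have := h (mem_filter.2 ⟨hi, hiq.ne⟩)
      simp at this
  have hp' : ∀ l ∈ s, Function.update (Function.update p j y) i q l ∈ Set.Icc (0 : ℝ) 1 := by
    intro l hl
    rcases eq_or_ne l i with rfl | hli
    · simpa using hq
    rcases eq_or_ne l j with rfl | hlj
    · simpa [hli] using ⟨hy0, hy1⟩
    · simpa [hli, hlj] using hp l hl
  rcases ih _ hlt hp' rfl with h | h
  · exact Or.inl (h.trans e2)
  · exact Or.inr (e1 ▸ h)

end PoissonBinomial

/-! ### Constant success probabilities: derivatives and the concave curve -/

section Binomial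

lemma pb_const {ι : Type*} (q : ℝ) (s : Finset ι) (c : ℕ) :
    pb (fun _ => q) s c = (bernsteinPolynomial ℝ s.card c).eval q := by
  have h : pb (fun _ => q) s c = s.card.choose c * q ^ c * (1 - q) ^ (s.card - c) := by
    rw [pb, prod_const, add_comm, add_pow, finsetSum_coeff]
    rw [sum_eq_single c]
    · rw [mul_pow, ← C_pow, ← C_pow, ← C_eq_natCast, mul_assoc, ← C_mul, mul_comm _ (C _),
        ← mul_assoc, ← C_mul, coeff_C_mul, coeff_X_pow_self]
      ring
    · intro b _ hb
      rw [mul_pow, ← C_pow, ← C_pow, ← C_eq_natCast, mul_assoc, ← C_mul, mul_comm _ (C _),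
        ← mul_assoc, ← C_mul, coeff_C_mul, coeff_X_pow, if_neg hb.symm, mul_zero]
    · intro hc
      have : s.card.choose c = 0 := Nat.choose_eq_zero_of_lt (by simpa using hc)
      simp [this]
  rw [h]
  simp [bernsteinPolynomial]

lemma hasDerivAt_pbLt_const (N k : ℕ) (q : ℝ) :
    HasDerivAt (fun q : ℝ => pbLt (fun _ => q) (range N) (k + 1))
      (-(N * (bernsteinPolynomial ℝ (N - 1) k).eval q)) q := by
  induction k with
  | zero =>
    simp only [pbLt, zero_add, sum_range_one, pb_const, card_range]
    refine ((bernsteinPolynomial ℝ N 0).hasDerivAt q).congr_deriv ?_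
    rw [bernsteinPolynomial.derivative_zero]; simp
  | succ k ih =>
    have e : (fun q : ℝ => pbLt (fun _ => q) (range N) (k + 1 + 1)) = fun q =>
        pbLt (fun _ => q) (range N) (k + 1) + (bernsteinPolynomial ℝ N (k + 1)).eval q := by
      funext q; rw [pbLt_succ, pb_const, card_range]
    rw [e]
    refine (ih.add ((bernsteinPolynomial ℝ N (k + 1)).hasDerivAt q)).congr_deriv ?_
    rw [bernsteinPolynomial.derivative_succ]; simp; ring

lemma hasDerivAt_pbMin_const (N k : ℕ) (q : ℝ) :
    HasDerivAt (fun q : ℝ => pbMin (fun _ => q) (range N) k)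
      (N * pbLt (fun _ => q) (range (N - 1)) k) q := by
  induction k with
  | zero => simpa [pbMin_zero, pbLt_zero] using hasDerivAt_const q (0 : ℝ)
  | succ k ih =>
    have e : (fun q : ℝ => pbMin (fun _ => q) (range N) (k + 1)) = fun q =>
        pbMin (fun _ => q) (range N) k + (1 - pbLt (fun _ => q) (range N) (k + 1)) := by
      funext q; rw [pbMin_succ]
    rw [e]
    refine (ih.add ((hasDerivAt_pbLt_const N k q).const_sub 1)).congr_deriv ?_
    rw [pbLt_succ, pb_const, card_range]; ring

/-- The monotone likelihood ratio of the binomial family: the comparison holds termwise and reduces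
to `(q(1-r))^d ≤ (r(1-q))^d` with `d = k - j`. -/
lemma pb_mul_pbLt_const_le {N k : ℕ} (hk : k ≤ N) {q r : ℝ} (hq : 0 ≤ q) (hqr : q ≤ r)
    (hr : r ≤ 1) :
    pb (fun _ => q) (range N) k * pbLt (fun _ => r) (range N) (k + 1) ≤
      pb (fun _ => r) (range N) k * pbLt (fun _ => q) (range N) (k + 1) := by
  unfold pbLt
  rw [mul_sum, mul_sum]
  refine sum_le_sum fun j hj => ?_
  obtain ⟨d, rfl⟩ : ∃ d, k = j + d := ⟨k - j, by simp at hj; omega⟩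
  obtain ⟨e, rfl⟩ : ∃ e, N = j + d + e := ⟨N - (j + d), by omega⟩
  simp only [pb_const, bernsteinPolynomial, card_range, eval_mul, eval_pow, eval_sub, eval_one,
    eval_X, eval_natCast]
  rw [show j + d + e - (j + d) = e by omega, show j + d + e - j = d + e by omega]
  have h1 : (q * (1 - r)) ^ d ≤ (r * (1 - q)) ^ d :=
    pow_le_pow_left₀ (mul_nonneg hq (by linarith)) (by nlinarith) d
  have h2 : 0 ≤ (((j + d + e).choose (j + d) : ℕ) : ℝ) * ((j + d + e).choose j : ℕ) *
      ((q * r) ^ j * ((1 - q) * (1 - r)) ^ e) := by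
    have : 0 ≤ (1 - q) * (1 - r) := mul_nonneg (by linarith) (by linarith)
    have := mul_nonneg hq (hq.trans hqr)
    positivity
  have h3 := mul_le_mul_of_nonneg_left h1 h2
  simp only [mul_pow] at h3
  simp only [pow_add]
  linarith

/-- The curve `q ↦ (P(Bin(N, q) < k + 1), 𝔼[min(Bin(N, q), k + 1)])` lies below its tangents. -/
lemma pbLt_pbMin_const_le_tangent {N k : ℕ} (hk : k + 1 ≤ N) {q r : ℝ}
    (hq : q ∈ Set.Icc (0 : ℝ) 1) (hr : r ∈ Set.Icc (0 : ℝ) 1) :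
    pbLt (fun _ => r) (range (N - 1)) (k + 1) * pbLt (fun _ => q) (range N) (k + 1) +
        pb (fun _ => r) (range (N - 1)) k * pbMin (fun _ => q) (range N) (k + 1) ≤
      pbLt (fun _ => r) (range (N - 1)) (k + 1) * pbLt (fun _ => r) (range N) (k + 1) +
        pb (fun _ => r) (range (N - 1)) k * pbMin (fun _ => r) (range N) (k + 1) := by
  set F := pbLt (fun _ => r) (range (N - 1)) (k + 1)
  set a := pb (fun _ => r) (range (N - 1)) k
  set g : ℝ → ℝ := fun q => F * pbLt (fun _ => q) (range N) (k + 1) +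
    a * pbMin (fun _ => q) (range N) (k + 1) with hg
  -- By the likelihood ratio comparison this derivative is nonnegative before `r` and nonpositive
  -- after it, so `g` is maximal at `r`.
  have hd : ∀ x, HasDerivAt g (N * (a * pbLt (fun _ => x) (range (N - 1)) (k + 1) -
      pb (fun _ => x) (range (N - 1)) k * F)) x := by
    intro x
    refine (((hasDerivAt_pbLt_const N k x).const_mul F).add
      ((hasDerivAt_pbMin_const N (k + 1) x).const_mul a)).congr_deriv ?_
    rw [pb_const, card_range]; ring
  have hc : Continuous g := continuous_iff_continuousAt.2 fun x => (hd x).continuousAt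
  have hN : (0 : ℝ) ≤ N := Nat.cast_nonneg N
  change g q ≤ g r
  rcases le_total q r with hqr | hrq
  · refine monotoneOn_of_deriv_nonneg (convex_Icc 0 r) hc.continuousOn
      (fun x _ => (hd x).differentiableAt.differentiableWithinAt) (fun x hx => ?_)
      ⟨hq.1, hqr⟩ ⟨hr.1, le_rfl⟩ hqr
    rw [interior_Icc] at hx
    rw [(hd x).deriv]
    exact mul_nonneg hN
      (sub_nonneg.2 (pb_mul_pbLt_const_le (by omega) hx.1.le hx.2.le hr.2))
  · refine antitoneOn_of_deriv_nonpos (convex_Icc r 1) hc.continuousOn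
      (fun x _ => (hd x).differentiableAt.differentiableWithinAt) (fun x hx => ?_)
      ⟨le_rfl, hr.2⟩ ⟨hrq, hq.2⟩ hrq
    rw [interior_Icc] at hx
    rw [(hd x).deriv]
    exact mul_nonpos_of_nonneg_of_nonpos hN
      (sub_nonpos.2 (pb_mul_pbLt_const_le (by omega) hr.1 hx.1.le hx.2.le))

lemma pb_const_zero {ι : Type*} (s : Finset ι) (c : ℕ) :
    pb (fun _ => 0) s c = if c = 0 then 1 else 0 := by
  rw [pb_const, bernsteinPolynomial.eval_at_0]

lemma pbLt_const_zero {ι : Type*} (s : Finset ι) (k : ℕ) : pbLt (fun _ => 0) s (k + 1) = 1 := by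
  simp [pbLt, pb_const_zero]

lemma pbMin_const_zero {ι : Type*} (s : Finset ι) (k : ℕ) : pbMin (fun _ => 0) s k = 0 := by
  simp [pbMin, pbLt_const_zero]

lemma pbLt_const_one {ι : Type*} (s : Finset ι) (k : ℕ) :
    pbLt (fun _ => 1) s k = if s.card < k then 1 else 0 := by
  simp only [pbLt, pb_const, bernsteinPolynomial.eval_at_1]
  simp

lemma pbMin_const_one {ι : Type*} (s : Finset ι) {k : ℕ} (hk : k ≤ s.card) :
    pbMin (fun _ => 1) s k = k := by
  rw [pbMin, sum_congr rfl fun c hc => by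
    rw [pbLt_const_one, if_neg (by simp at hc; omega)]]
  simp

/-- The success probability at which `P(Bin(N, q) < k) = 𝔼[min(Bin(N, q), k)] / k`. -/
lemma exists_balanced_const {N k : ℕ} (hk : k + 1 ≤ N) :
    ∃ q ∈ Set.Icc (0 : ℝ) 1, 0 < pbLt (fun _ => q) (range N) (k + 1) ∧
      pbMin (fun _ => q) (range N) (k + 1) =
      ((k + 1 : ℕ) : ℝ) * pbLt (fun _ => q) (range N) (k + 1) := by
  set g : ℝ → ℝ := fun q => pbMin (fun _ => q) (range N) (k + 1) -
    ((k + 1 : ℕ) : ℝ) * pbLt (fun _ => q) (range N) (k + 1) with hg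
  have hc : Continuous g := continuous_iff_continuousAt.2 fun x =>
    ((hasDerivAt_pbMin_const N (k + 1) x).continuousAt).sub
      (continuousAt_const.mul (hasDerivAt_pbLt_const N k x).continuousAt)
  have h0 : g 0 ≤ 0 := by
    simp only [hg, pbMin_const_zero, pbLt_const_zero]
    have : (0 : ℝ) ≤ ((k + 1 : ℕ) : ℝ) := Nat.cast_nonneg _
    linarith
  have h1 : 0 ≤ g 1 := by
    have hN : k + 1 ≤ (range N).card := by simpa using hk
    simp only [hg, pbMin_const_one _ hN, pbLt_const_one, if_neg hN.not_gt]
    have : (0 : ℝ) ≤ ((k + 1 : ℕ) : ℝ) := Nat.cast_nonneg _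
    linarith
  obtain ⟨q, hq, hgq⟩ := intermediate_value_Icc zero_le_one hc.continuousOn ⟨h0, h1⟩
  have heq := sub_eq_zero.1 hgq
  refine ⟨q, hq, ?_, heq⟩
  have hnn : ∀ j, 0 ≤ pbLt (fun _ => q) (range N) j := pbLt_nonneg fun _ _ => hq
  -- If `P(S < k + 1)` vanished, at least `k + 1` successes would be certain, forcing the truncated
  -- mean to be at least `1`, while the balance makes it `0`.
  refine (hnn _).lt_of_ne' fun h => ?_
  rw [h, mul_zero, pbMin_succ, h] at heq
  have : 0 ≤ pbMin (fun _ => q) (range N) k :=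
    sum_nonneg fun c _ => sub_nonneg.2 (pbLt_le_one (fun _ _ => hq) _)
  linarith

end Binomial

/-! ### From the state variables to clearing counts -/

section Model

open MeasureTheory

/-- Extension by zero of a finite family of probabilities. -/
def extendZero {n : ℕ} (τ : Fin n → ℝ) (i : ℕ) : ℝ := if h : i < n then τ ⟨i, h⟩ else 0

lemma extendZero_val {n : ℕ} (τ : Fin n → ℝ) (i : Fin n) : extendZero τ i = τ i := by
  simp [extendZero]

lemma extendZero_mem {n : ℕ} {τ : Fin n → ℝ} (hτ : ∀ i, τ i ∈ Set.Icc (0 : ℝ) 1) (i : ℕ) :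
    extendZero τ i ∈ Set.Icc (0 : ℝ) 1 := by
  unfold extendZero
  split_ifs
  · exact hτ _
  · norm_num

/-- The shifted index `l` means `l + 1` free slots, that is, `k - 1 - l` earlier successes. The
update constraint thus becomes the Poisson binomial recursion. -/
lemma state_step {k : ℕ} (p : ℕ → ℝ) (i l : ℕ) (hl : l < k) :
    pb p (range (i + 1)) (k - 1 - l) = pb p (range i) (k - 1 - l) -
      p i * pb p (range i) (k - 1 - l) +
      if l + 1 < k then p i * pb p (range i) (k - 1 - (l + 1)) else 0 := by
  rw [range_add_one]
  split_ifs with h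
  · obtain ⟨d, rfl⟩ : ∃ d, k = l + 1 + 1 + d := ⟨k - (l + 1 + 1), by omega⟩
    rw [show l + 1 + 1 + d - 1 - l = d + 1 by omega,
      show l + 1 + 1 + d - 1 - (l + 1) = d by omega, pb_insert_succ p notMem_range_self]
    ring
  · rw [show k - 1 - l = 0 by omega, pb_insert_zero p notMem_range_self]
    ring

/-- The state probabilities of a static threshold are those of a Poisson binomial count. -/
lemma state_eq_pb {n k : ℕ} {τ : Fin n → ℝ} {x y : Fin n → Fin k → ℝ}
    (h : (x, y) ∈ stateSet n k) (hy : ∀ i l, y i l = τ i * x i l) (i : Fin n) (l : Fin k) :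
    x i l = pb (extendZero τ) (range i) (k - 1 - l) := by
  obtain ⟨-, h0, hs, -⟩ := h
  obtain ⟨i, hi⟩ := i
  induction i generalizing l with
  | zero =>
    rw [show x ⟨0, hi⟩ l = _ from h0 ⟨0, hi⟩ l rfl, range_zero, pb_empty]
    have := l.2
    congr 1
    simp only [eq_iff_iff]
    omega
  | succ i ih =>
    have hi' : i < n := by omega
    have e : extendZero τ i = τ ⟨i, hi'⟩ := extendZero_val τ ⟨i, hi'⟩
    have h1 := hs ⟨i, hi'⟩ hi l
    simp only [hy] at h1
    rw [h1, state_step _ _ _ l.2, ih l hi', e]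
    simp only [fun l => ih l hi', dite_eq_ite]

lemma pb_mem_stateSet {n k : ℕ} {τ : Fin n → ℝ} (hτ : ∀ i, τ i ∈ Set.Icc (0 : ℝ) 1) :
    ((fun i l => pb (extendZero τ) (range i) (k - 1 - l),
      fun i l => τ i * pb (extendZero τ) (range i) (k - 1 - l)) :
      (Fin n → Fin k → ℝ) × (Fin n → Fin k → ℝ)) ∈ stateSet n k := by
  have hnn : ∀ i c, 0 ≤ pb (extendZero τ) (range i) c := fun i c =>
    pb_nonneg (fun j _ => extendZero_mem hτ j) c
  refine ⟨fun i l => mul_le_of_le_one_left (hnn _ _) (hτ i).2, fun i l hi => ?_,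
    fun i hi l => ?_, fun i l => mul_nonneg (hτ i).1 (hnn _ _)⟩
  · have := l.2
    simp only [hi, range_zero, pb_empty]
    congr 1
    simp only [eq_iff_iff]
    omega
  · have := state_step (extendZero τ) i l l.2
    rw [extendZero_val] at this
    simpa only [dite_eq_ite] using this

lemma sum_min_eq {n k : ℕ} {τ g : Fin n → ℝ} (hτ : ∀ i, τ i ∈ Set.Icc (0 : ℝ) 1)
    {x y : Fin n → Fin k → ℝ} (h : (x, y) ∈ stateSet n k) (hy : ∀ i l, y i l = τ i * x i l) :
    ∑ i, ∑ l, min (y i l) (g i * x i l) =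
      ∑ i : Fin n, min (τ i) (g i) * pbLt (extendZero τ) (range i) k := by
  refine sum_congr rfl fun i _ => ?_
  have e : ∀ l, min (y i l) (g i * x i l) =
      min (τ i) (g i) * pb (extendZero τ) (range i) (k - 1 - l) := fun l => by
    rw [hy, state_eq_pb h hy, min_mul_of_nonneg _ _ (pb_nonneg (fun j _ => extendZero_mem hτ j) _)]
  simp only [e]
  rw [← mul_sum, pbLt, Fin.sum_univ_eq_sum_range (fun l => pb (extendZero τ) (range i) (k - 1 - l)),
    sum_range_reflect]

/-- Telescoping of `pbMin_insert`: agent `i` is accepted when it clears and fewer than `k`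
predecessors did. -/
lemma sum_mul_pbLt {n : ℕ} (τ : Fin n → ℝ) (k : ℕ) :
    ∑ i : Fin n, τ i * pbLt (extendZero τ) (range i) k = pbMin (extendZero τ) (range n) k := by
  have : ∀ (p : ℕ → ℝ) (m : ℕ), ∑ i ∈ range m, p i * pbLt p (range i) k = pbMin p (range m) k := by
    intro p m
    induction m with
    | zero => simp [pbMin_empty]
    | succ m ih => rw [sum_range_succ, ih, range_add_one, pbMin_insert p notMem_range_self]
  rw [← this, ← Fin.sum_univ_eq_sum_range fun i => extendZero τ i * pbLt (extendZero τ) (range i) k]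
  simp only [extendZero_val]

variable {n : ℕ} (D : TypeDist n)

lemma TypeDist.G_mem (i : Fin n) (j : Fin (D.m + 1)) : D.G i j ∈ Set.Icc (0 : ℝ) 1 :=
  ⟨(D.G_zero i).symm.le.trans (D.G_mono i (Fin.zero_le j)),
    (D.G_mono i (Fin.le_last j)).trans (D.G_last i).le⟩

lemma TypeDist.clearProb_mem_Icc (J : Fin D.m) {ρ : ℝ} (hρ : ρ ∈ Set.Icc (0 : ℝ) 1) (i : Fin n) :
    D.clearProb J ρ i ∈ Set.Icc (D.G i J.castSucc) (D.G i J.succ) := by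
  have h := D.G_mono i (Fin.castSucc_lt_succ (i := J)).le
  unfold TypeDist.clearProb
  constructor <;> nlinarith [hρ.1, hρ.2]

lemma TypeDist.clearProb_mem (J : Fin D.m) {ρ : ℝ} (hρ : ρ ∈ Set.Icc (0 : ℝ) 1) (i : Fin n) :
    D.clearProb J ρ i ∈ Set.Icc (0 : ℝ) 1 :=
  ⟨(D.G_mem i _).1.trans (D.clearProb_mem_Icc J hρ i).1,
    (D.clearProb_mem_Icc J hρ i).2.trans (D.G_mem i _).2⟩

lemma TypeDist.m_pos (hn : 1 ≤ n) : 0 < D.m := by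
  rcases Nat.eq_zero_or_pos D.m with h | h
  · have h1 := D.G_last ⟨0, hn⟩
    have h2 : Fin.last D.m = 0 := Fin.ext (by simp [h])
    rw [h2, D.G_zero] at h1
    norm_num at h1
  · exact h

variable {k : ℕ}

lemma TypeDist.coverage_eq (J : Fin D.m) {ρ : ℝ} (hρ : ρ ∈ Set.Icc (0 : ℝ) 1)
    {x y : Fin n → Fin k → ℝ} (h : (x, y) ∈ stateSet n k)
    (hy : ∀ i l, y i l = D.clearProb J ρ i * x i l) (j : Fin D.m) :
    D.coverage x y j = ∑ i : Fin n, min (D.clearProb J ρ i) (D.G i j.succ) *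
      pbLt (extendZero (D.clearProb J ρ)) (range i) k :=
  sum_min_eq (D.clearProb_mem J hρ) h hy

lemma feasibleOST_iff (Q : Fin D.m → ℝ) (J : Fin D.m) {ρ : ℝ} (hρ : ρ ∈ Set.Icc (0 : ℝ) 1)
    (θ : ℝ) : FeasibleOST k D Q J ρ θ ↔ ∀ j, θ * Q j ≤
      ∑ i : Fin n, min (D.clearProb J ρ i) (D.G i j.succ) *
        pbLt (extendZero (D.clearProb J ρ)) (range i) k := by
  constructor
  · rintro ⟨x, y, h, hy, hQ⟩ j
    exact (hQ j).trans_eq (D.coverage_eq J hρ h hy j)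
  · intro hQ
    have hmem := pb_mem_stateSet (k := k) (D.clearProb_mem J hρ)
    exact ⟨_, _, hmem, fun _ _ => rfl,
      fun j => (hQ j).trans_eq (D.coverage_eq J hρ hmem (fun _ _ => rfl) j).symm⟩

/-- The constraints determine the state variables for each threshold, so only the mixing measure
remains to be chosen. -/
lemma feasibleST_iff (Q : Fin D.m → ℝ) (θ : ℝ) : FeasibleST k D Q θ ↔
    ∃ μ : Measure (Fin D.m × Set.Ioc (0 : ℝ) 1), IsProbabilityMeasure μ ∧ ∀ j, θ * Q j ≤
      ∫ t, ∑ i : Fin n, min (D.clearProb t.1 t.2 i) (D.G i j.succ) *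
        pbLt (extendZero (D.clearProb t.1 t.2)) (range i) k ∂μ := by
  have hIcc : ∀ t : Fin D.m × Set.Ioc (0 : ℝ) 1, (t.2 : ℝ) ∈ Set.Icc (0 : ℝ) 1 := fun t =>
    Set.Ioc_subset_Icc_self t.2.2
  constructor
  · rintro ⟨x, y, μ, hμ, h, hy, hQ⟩
    refine ⟨μ, hμ, fun j => (hQ j).trans_eq ?_⟩
    congr 1
    funext t
    exact D.coverage_eq t.1 (hIcc t) (h t) (hy t) j
  · rintro ⟨μ, hμ, hQ⟩
    have hmem := fun t => pb_mem_stateSet (k := k) (D.clearProb_mem t.1 (hIcc t))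
    refine ⟨_, _, μ, hμ, hmem, fun _ _ _ => rfl, fun j => (hQ j).trans_eq ?_⟩
    congr 1
    funext t
    exact (D.coverage_eq t.1 (hIcc t) (hmem t) (fun _ _ => rfl) j).symm

lemma FeasibleOST.feasibleST {Q : Fin D.m → ℝ} {J : Fin D.m} {ρ : Set.Ioc (0 : ℝ) 1} {θ : ℝ}
    (h : FeasibleOST k D Q J ρ θ) : FeasibleST k D Q θ := by
  rw [feasibleOST_iff D Q J (Set.Ioc_subset_Icc_self ρ.2)] at h
  rw [feasibleST_iff]
  refine ⟨Measure.dirac (J, ρ), inferInstance, fun j => (h j).trans_eq ?_⟩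
  rw [integral_dirac]

lemma coverage_nonneg (J : Fin D.m) {ρ : ℝ} (hρ : ρ ∈ Set.Icc (0 : ℝ) 1) (j : Fin D.m) :
    0 ≤ ∑ i : Fin n, min (D.clearProb J ρ i) (D.G i j.succ) *
      pbLt (extendZero (D.clearProb J ρ)) (range i) k :=
  sum_nonneg fun i _ => mul_nonneg (le_min (D.clearProb_mem J hρ i).1 (D.G_mem i _).1)
    (pbLt_nonneg (fun _ _ => extendZero_mem (D.clearProb_mem J hρ) _) _)

/-! ### Expectations over success sets and comparison of the four values -/

section Bernoulli

variable {p : Fin n → ℝ}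

lemma bernoulli_weight_nonneg (hp : ∀ i, p i ∈ Set.Icc (0 : ℝ) 1) (S : Finset (Fin n)) :
    0 ≤ (∏ i ∈ S, p i) * ∏ i ∈ Sᶜ, (1 - p i) :=
  mul_nonneg (prod_nonneg fun i _ => (hp i).1) (prod_nonneg fun i _ => sub_nonneg.2 (hp i).2)

lemma bernoulliSumExp_mono (hp : ∀ i, p i ∈ Set.Icc (0 : ℝ) 1) {f g : ℕ → ℝ} (h : ∀ s, f s ≤ g s) :
    bernoulliSumExp p f ≤ bernoulliSumExp p g :=
  sum_le_sum fun S _ => mul_le_mul_of_nonneg_left (h _) (bernoulli_weight_nonneg hp S)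

lemma weight_mul_le_bernoulliSumExp (hp : ∀ i, p i ∈ Set.Icc (0 : ℝ) 1) {f : ℕ → ℝ}
    (h : ∀ s, 0 ≤ f s) (S : Finset (Fin n)) :
    (∏ i ∈ S, p i) * (∏ i ∈ Sᶜ, (1 - p i)) * f S.card ≤ bernoulliSumExp p f :=
  single_le_sum (f := fun S : Finset (Fin n) => (∏ i ∈ S, p i) * (∏ i ∈ Sᶜ, (1 - p i)) * f S.card)
    (fun S _ => mul_nonneg (bernoulli_weight_nonneg hp S) (h _)) (mem_univ S)

lemma bernoulliSumExp_const (p : Fin n → ℝ) (c : ℝ) : bernoulliSumExp p (fun _ => c) = c := by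
  rw [bernoulliSumExp, ← sum_mul, ← Fintype.prod_add]
  simp

lemma bernoulliSumExp_id (p : Fin n → ℝ) : bernoulliSumExp p (fun s => (s : ℝ)) = ∑ i, p i := by
  have h : ∀ i, ∑ S : Finset (Fin n), (∏ j ∈ S, p j) * (∏ j ∈ Sᶜ, (1 - p j)) *
      (if i ∈ S then 1 else 0) = p i := by
    intro i
    -- The indicator of `i ∈ S` is absorbed by setting the failure factor of `i` to `0`, so that the
    -- sum over `S` factorizes.
    have e : ∀ S : Finset (Fin n), (∏ j ∈ S, p j) * (∏ j ∈ Sᶜ, (1 - p j)) *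
        (if i ∈ S then 1 else 0) =
        (∏ j ∈ S, p j) * ∏ j ∈ Sᶜ, (if j = i then 0 else 1 - p j) := by
      intro S
      by_cases hi : i ∈ S
      · rw [if_pos hi, mul_one]
        congr 1
        refine prod_congr rfl fun j hj => (if_neg ?_).symm
        rintro rfl
        exact (mem_compl.1 hj) hi
      · have h0 : ∏ j ∈ Sᶜ, (if j = i then 0 else 1 - p j) = 0 :=
          prod_eq_zero (mem_compl.2 hi) (if_pos rfl)
        rw [if_neg hi, mul_zero, h0, mul_zero]
    rw [sum_congr rfl fun S _ => e S, ← Fintype.prod_add, prod_eq_single i]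
    · simp
    · intro j _ hj
      simp [hj]
    · simp
  rw [← sum_congr rfl fun i _ => h i, sum_comm]
  refine sum_congr rfl fun S _ => ?_
  rw [← mul_sum]
  simp

end Bernoulli

lemma prophQ_le_exAnteQ (j : Fin D.m) : prophQ k D j ≤ exAnteQ k D j := by
  have hp : ∀ i, D.G i j.succ ∈ Set.Icc (0 : ℝ) 1 := fun i => D.G_mem i _
  refine le_min ?_ ?_
  · rw [← bernoulliSumExp_id]
    exact bernoulliSumExp_mono hp fun s => min_le_left _ _
  · rw [← bernoulliSumExp_const (fun i => D.G i j.succ) (k : ℝ)]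
    exact bernoulliSumExp_mono hp fun s => min_le_right _ _

lemma innerLPOST_exAnteQ_le (J : Fin D.m) (ρ : Set.Ioc (0 : ℝ) 1) :
    innerLPOST k D (exAnteQ k D) J ρ ≤ innerLPOST k D (prophQ k D) J ρ := by
  refine iSup₂_le fun θ h => ?_
  rw [feasibleOST_iff D _ J (Set.Ioc_subset_Icc_self ρ.2)] at h
  -- Lowering the benchmark preserves feasibility only for nonnegative `θ`; for negative `θ` the
  -- always feasible value `0` is used instead.
  have hmax : FeasibleOST k D (prophQ k D) J ρ (max θ 0) := by
    rw [feasibleOST_iff D _ J (Set.Ioc_subset_Icc_self ρ.2)]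
    intro j
    rcases le_total θ 0 with h0 | h0
    · rw [max_eq_right h0, zero_mul]
      exact coverage_nonneg D J (Set.Ioc_subset_Icc_self ρ.2) j
    · rw [max_eq_left h0]
      exact (mul_le_mul_of_nonneg_left (prophQ_le_exAnteQ D j) h0).trans (h j)
  exact (EReal.coe_le_coe_iff.2 (le_max_left θ 0)).trans
    (le_iSup₂ (f := fun (θ : ℝ) (_ : FeasibleOST k D (prophQ k D) J ρ θ) => (θ : EReal)) _ hmax)

lemma innerLPST_exAnteQ_le : innerLPST k D (exAnteQ k D) ≤ innerLPST k D (prophQ k D) := by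
  refine iSup₂_le fun θ h => ?_
  rw [feasibleST_iff] at h
  obtain ⟨μ, hμ, h⟩ := h
  have hmax : FeasibleST k D (prophQ k D) (max θ 0) := by
    rw [feasibleST_iff]
    refine ⟨μ, hμ, fun j => ?_⟩
    rcases le_total θ 0 with h0 | h0
    · rw [max_eq_right h0, zero_mul]
      exact integral_nonneg fun t => coverage_nonneg D t.1 (Set.Ioc_subset_Icc_self t.2.2) j
    · rw [max_eq_left h0]
      exact (mul_le_mul_of_nonneg_left (prophQ_le_exAnteQ D j) h0).trans (h j)
  exact (EReal.coe_le_coe_iff.2 (le_max_left θ 0)).trans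
    (le_iSup₂ (f := fun (θ : ℝ) (_ : FeasibleST k D (prophQ k D) θ) => (θ : EReal)) _ hmax)

lemma iSup_innerLPOST_le_innerLPST (Q : Fin D.m → ℝ) :
    ⨆ (J : Fin D.m) (ρ : Set.Ioc (0 : ℝ) 1), innerLPOST k D Q J ρ ≤ innerLPST k D Q :=
  iSup₂_le fun _ _ => iSup₂_le fun θ h =>
    le_iSup₂ (f := fun (θ : ℝ) (_ : FeasibleST k D Q θ) => (θ : EReal)) θ h.feasibleST

end Model

/-! ### The guarantee of a balanced threshold -/

section WorstCase

open MeasureTheory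

lemma continuous_pb {ι T : Type*} [TopologicalSpace T] {p : T → ι → ℝ} {s : Finset ι}
    (hp : ∀ i ∈ s, Continuous fun t => p t i) (c : ℕ) : Continuous fun t => pb (p t) s c := by
  classical
  induction s using Finset.induction_on generalizing c with
  | empty => simpa only [pb_empty] using continuous_const
  | insert i s hi ih =>
    have h1 := hp i (mem_insert_self _ _)
    have h2 := ih fun j hj => hp j (mem_insert_of_mem hj)
    cases c with
    | zero =>
      simp only [pb_insert_zero _ hi]
      exact (continuous_const.sub h1).mul (h2 _)
    | succ c =>
      simp only [pb_insert_succ _ hi]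
      exact ((continuous_const.sub h1).mul (h2 _)).add (h1.mul (h2 _))

lemma continuous_pbLt {ι T : Type*} [TopologicalSpace T] {p : T → ι → ℝ} {s : Finset ι}
    (hp : ∀ i ∈ s, Continuous fun t => p t i) (k : ℕ) : Continuous fun t => pbLt (p t) s k :=
  continuous_finsetSum _ fun c _ => continuous_pb hp c

lemma continuous_pbMin {ι T : Type*} [TopologicalSpace T] {p : T → ι → ℝ} {s : Finset ι}
    (hp : ∀ i ∈ s, Continuous fun t => p t i) (k : ℕ) : Continuous fun t => pbMin (p t) s k :=
  continuous_finsetSum _ fun c _ => continuous_const.sub (continuous_pbLt hp (c + 1))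

lemma pbLt_range_antitone {p : ℕ → ℝ} (hp : ∀ i, p i ∈ Set.Icc (0 : ℝ) 1) (k : ℕ) :
    Antitone fun i => pbLt p (range i) k :=
  antitone_nat_of_succ_le fun i => by
    rw [range_add_one]
    exact pbLt_insert_le notMem_range_self (fun j _ => hp j) (hp i).1 k

lemma pbLt_extendZero_congr {N : ℕ} {τ : Fin (N + 1) → ℝ} {q : ℝ}
    (h : ∀ i : Fin N, τ i.castSucc = q) (k : ℕ) :
    pbLt (extendZero τ) (range N) k = pbLt (fun _ => q) (range N) k :=
  pbLt_congr (fun i hi => by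
    rw [mem_range] at hi
    rw [← h ⟨i, hi⟩]
    exact extendZero_val τ (Fin.castSucc ⟨i, hi⟩)) k

lemma pbMin_extendZero_congr {N : ℕ} {τ : Fin (N + 1) → ℝ} {q : ℝ}
    (h : ∀ i : Fin N, τ i.castSucc = q) (k : ℕ) :
    pbMin (extendZero τ) (range N) k = pbMin (fun _ => q) (range N) k :=
  sum_congr rfl fun _ _ => by rw [pbLt_extendZero_congr h]

lemma pbMin_extendZero_succ {N : ℕ} (τ : Fin (N + 1) → ℝ) (k : ℕ) :
    pbMin (extendZero τ) (range (N + 1)) k =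
      pbMin (extendZero τ) (range N) k + τ (Fin.last N) * pbLt (extendZero τ) (range N) k := by
  rw [range_add_one, pbMin_insert _ notMem_range_self]
  congr 2
  exact extendZero_val τ (Fin.last N)

/-- Some static threshold balances `P(S < k)` and `𝔼[min(S, k)] / k`, where `S` counts the agents
other than the last one who clear it. -/
lemma TypeDist.exists_balanced {N k : ℕ} (hk : k + 1 ≤ N) (D : TypeDist (N + 1)) :
    ∃ (J : Fin D.m) (ρ : Set.Ioc (0 : ℝ) 1),
      pbMin (extendZero (D.clearProb J ρ)) (range N) (k + 1) =
        ((k + 1 : ℕ) : ℝ) * pbLt (extendZero (D.clearProb J ρ)) (range N) (k + 1) := by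
  set f : (ℕ → ℝ) → ℝ := fun p => pbMin p (range N) (k + 1) -
    ((k + 1 : ℕ) : ℝ) * pbLt p (range N) (k + 1) with hf
  have hkpos : (0 : ℝ) < ((k + 1 : ℕ) : ℝ) := by positivity
  have h0 : f (extendZero fun i => D.G i 0) < 0 := by
    simp only [hf]
    rw [pbLt_extendZero_congr (q := 0) (fun i => D.G_zero _),
      pbMin_extendZero_congr (q := 0) (fun i => D.G_zero _), pbMin_const_zero, pbLt_const_zero]
    linarith
  have h1 : 0 ≤ f (extendZero fun i => D.G i (Fin.last D.m)) := by
    have hN : k + 1 ≤ (range N).card := by simpa using hk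
    simp only [hf]
    rw [pbLt_extendZero_congr (q := 1) (fun i => D.G_last _),
      pbMin_extendZero_congr (q := 1) (fun i => D.G_last _), pbMin_const_one _ hN, pbLt_const_one,
      if_neg hN.not_gt]
    linarith
  -- The cutoff is a type at which the sign of `f` changes; the tie-break then interpolates
  -- continuously. Strict negativity on the left later excludes `ρ = 0`.
  obtain ⟨J, hJ0, hJ1⟩ : ∃ J : Fin D.m, f (extendZero fun i => D.G i J.castSucc) < 0 ∧
      0 ≤ f (extendZero fun i => D.G i J.succ) := by
    by_contra! hcon
    have : ∀ j : Fin (D.m + 1), f (extendZero fun i => D.G i j) < 0 :=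
      Fin.induction h0 fun J hJ => hcon J hJ
    exact (this _).not_ge h1
  have hcont : ∀ i : ℕ, Continuous fun ρ : ℝ => extendZero (D.clearProb J ρ) i := by
    intro i
    unfold extendZero TypeDist.clearProb
    split_ifs <;> fun_prop
  have hc : Continuous fun ρ : ℝ => f (extendZero (D.clearProb J ρ)) :=
    (continuous_pbMin (fun i _ => hcont i) _).sub
      (continuous_const.mul (continuous_pbLt (fun i _ => hcont i) _))
  have e0 : D.clearProb J 0 = fun i => D.G i J.castSucc := by
    funext i; simp [TypeDist.clearProb]
  have e1 : D.clearProb J 1 = fun i => D.G i J.succ := by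
    funext i; simp [TypeDist.clearProb]
  obtain ⟨ρ, hρ, hfρ⟩ := intermediate_value_Icc zero_le_one hc.continuousOn
    (show (0 : ℝ) ∈ _ from ⟨by rw [e0]; exact hJ0.le, by rw [e1]; exact hJ1⟩)
  refine ⟨J, ⟨ρ, hρ.1.lt_of_ne ?_, hρ.2⟩, sub_eq_zero.1 hfρ⟩
  rintro rfl
  simp only [e0] at hfρ
  exact hJ0.ne hfρ

lemma TypeDist.exists_feasibleOST {N k : ℕ} (hk : k + 1 ≤ N) {q : ℝ} (hq : q ∈ Set.Icc (0 : ℝ) 1)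
    (hbal : pbMin (fun _ => q) (range N) (k + 1) =
      ((k + 1 : ℕ) : ℝ) * pbLt (fun _ => q) (range N) (k + 1)) (D : TypeDist (N + 1)) :
    ∃ (J : Fin D.m) (ρ : Set.Ioc (0 : ℝ) 1), FeasibleOST (k + 1) D (exAnteQ (k + 1) D) J ρ
      (pbLt (fun _ => q) (range N) (k + 1)) := by
  obtain ⟨J, ρ, hJ⟩ := D.exists_balanced hk
  have hρ := Set.Ioc_subset_Icc_self ρ.2
  refine ⟨J, ρ, ?_⟩
  rw [feasibleOST_iff D _ J hρ]
  set V := pbLt (fun _ => q) (range N) (k + 1)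
  set τ := D.clearProb J ρ with hτdef
  have hτ : ∀ i, τ i ∈ Set.Icc (0 : ℝ) 1 := D.clearProb_mem J hρ
  have hp := extendZero_mem hτ
  have hkpos : (0 : ℝ) < ((k + 1 : ℕ) : ℝ) := by positivity
  have hV0 : 0 ≤ V := pbLt_nonneg (fun _ _ => hq) _
  have hA : V ≤ pbLt (extendZero τ) (range N) (k + 1) := by
    rcases pbLt_const_le_or_pbMin_const_le (p := extendZero τ) (s := range N) hq
      (fun i _ => hp i) (k + 1) with h | h
    · exact h
    · rw [hbal, hJ] at h
      exact le_of_mul_le_mul_left h hkpos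
  intro j
  rcases le_or_gt J j with hj | hj
  · have hmin : ∀ i, min (τ i) (D.G i j.succ) = τ i := fun i => min_eq_left
      ((D.clearProb_mem_Icc J hρ i).2.trans (D.G_mono i (Fin.succ_le_succ_iff.2 hj)))
    simp only [hmin]
    -- Every accepted agent counts here. The first `N` agents already contribute `k + 1` times the
    -- balanced probability, and the last agent's share is only dropped.
    rw [sum_mul_pbLt, pbMin_extendZero_succ, hJ]
    have h1 : V * exAnteQ (k + 1) D j ≤ V * ((k + 1 : ℕ) : ℝ) :=
      mul_le_mul_of_nonneg_left (min_le_right _ _) hV0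
    have h2 := mul_le_mul_of_nonneg_left hA hkpos.le
    have h3 := mul_nonneg (hτ (Fin.last N)).1 (hV0.trans hA)
    linarith
  · have hmin : ∀ i, min (τ i) (D.G i j.succ) = D.G i j.succ := fun i => min_eq_right
      ((D.G_mono i (by
        rw [Fin.le_def]
        simpa using hj)).trans (D.clearProb_mem_Icc J hρ i).1)
    simp only [hmin]
    -- All types up to `j` clear the threshold, and each agent has at most `N` predecessors, hence a
    -- free slot with probability at least `V`.
    calc V * exAnteQ (k + 1) D j ≤ V * ∑ i, D.G i j.succ :=
          mul_le_mul_of_nonneg_left (min_le_left _ _) hV0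
      _ = ∑ i, D.G i j.succ * V := by rw [mul_sum]; exact sum_congr rfl fun _ _ => mul_comm _ _
      _ ≤ _ := sum_le_sum fun i _ => mul_le_mul_of_nonneg_left
          (hA.trans (pbLt_range_antitone hp (k + 1) (Nat.lt_succ_iff.1 i.2))) (D.G_mem i _).1

/-! ### The spike instance and the upper bound -/

/-- Three types, where all agents but the last have the middle type and the last agent has the best
type with probability `ε` and the worst type otherwise. -/
def spikeDist (N : ℕ) {ε : ℝ} (h0 : 0 ≤ ε) (h1 : ε ≤ 1) : TypeDist (N + 1) where
  m := 3
  G := Fin.lastCases ![0, ε, ε, 1] fun _ => ![0, 0, 1, 1]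
  G_zero i := by
    refine Fin.lastCases ?_ (fun i => ?_) i <;> simp
  G_mono i := by
    refine Fin.lastCases ?_ (fun i => ?_) i
    · rw [Fin.lastCases_last, Fin.monotone_iff_le_succ]
      intro j
      fin_cases j <;> simp [h0, h1]
    · rw [Fin.lastCases_castSucc, Fin.monotone_iff_le_succ]
      intro j
      fin_cases j <;> simp
  G_last i := by
    refine Fin.lastCases ?_ (fun i => ?_) i
    · rw [Fin.lastCases_last]; rfl
    · rw [Fin.lastCases_castSucc]; rfl

section Spike

variable {N : ℕ} {ε : ℝ} (h0 : 0 ≤ ε) (h1 : ε ≤ 1)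

lemma spikeDist_G_last : (spikeDist N h0 h1).G (Fin.last N) = ![0, ε, ε, 1] := by
  simp [spikeDist]

lemma spikeDist_G_castSucc (i : Fin N) : (spikeDist N h0 h1).G i.castSucc = ![0, 0, 1, 1] := by
  simp [spikeDist]

/-- The static thresholds clear all agents but the last with a common probability, and cover the
best type and all types as if there were only the spike of the last agent, and only the other
agents up to an error `ε`, respectively. -/
lemma spikeDist_coverage_le {k : ℕ} (hk : k + 1 ≤ N) (J : Fin (spikeDist N h0 h1).m) {ρ : ℝ}
    (hρ : ρ ∈ Set.Icc (0 : ℝ) 1) : ∃ r ∈ Set.Icc (0 : ℝ) 1,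
      ∑ i : Fin (N + 1), min ((spikeDist N h0 h1).clearProb J ρ i)
          ((spikeDist N h0 h1).G i (Fin.succ (0 : Fin 3))) *
          pbLt (extendZero ((spikeDist N h0 h1).clearProb J ρ)) (range i) (k + 1) ≤
        ε * pbLt (fun _ => r) (range N) (k + 1) ∧
      ∑ i : Fin (N + 1), min ((spikeDist N h0 h1).clearProb J ρ i)
          ((spikeDist N h0 h1).G i (Fin.succ (2 : Fin 3))) *
          pbLt (extendZero ((spikeDist N h0 h1).clearProb J ρ)) (range i) (k + 1) ≤
        pbMin (fun _ => r) (range N) (k + 1) + ε := by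
  have hτ := (spikeDist N h0 h1).clearProb_mem J hρ
  obtain ⟨r, hr, hcast, hlast⟩ : ∃ r ∈ Set.Icc (0 : ℝ) 1,
      (∀ i : Fin N, (spikeDist N h0 h1).clearProb J ρ i.castSucc = r) ∧
      (spikeDist N h0 h1).clearProb J ρ (Fin.last N) *
        pbLt (fun _ => r) (range N) (k + 1) ≤ ε := by
    have hle : ∀ r ∈ Set.Icc (0 : ℝ) 1, (spikeDist N h0 h1).clearProb J ρ (Fin.last N) ≤ ε →
        (spikeDist N h0 h1).clearProb J ρ (Fin.last N) *
          pbLt (fun _ => r) (range N) (k + 1) ≤ ε := fun r hr h =>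
      (mul_le_of_le_one_right (hτ _).1 (pbLt_le_one (fun _ _ => hr) _)).trans h
    have hcl : ∀ J i, (spikeDist N h0 h1).clearProb J ρ i =
        (1 - ρ) * (spikeDist N h0 h1).G i J.castSucc + ρ * (spikeDist N h0 h1).G i J.succ :=
      fun _ _ => rfl
    have hJ : J = (0 : Fin 3) ∨ J = (1 : Fin 3) ∨ J = (2 : Fin 3) := by
      have : ∀ j : Fin 3, j = 0 ∨ j = 1 ∨ j = 2 := by decide
      exact this J
    rcases hJ with rfl | rfl | rfl
    · refine ⟨0, by norm_num, fun i => ?_, hle 0 (by norm_num) ?_⟩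
      · refine (hcl _ _).trans ?_
        rw [spikeDist_G_castSucc]
        change (1 - ρ) * 0 + ρ * 0 = (0 : ℝ)
        ring
      · refine (hcl _ _).le.trans ?_
        rw [spikeDist_G_last]
        change (1 - ρ) * 0 + ρ * ε ≤ ε
        nlinarith [hρ.2]
    · refine ⟨ρ, hρ, fun i => ?_, hle ρ hρ ?_⟩
      · refine (hcl _ _).trans ?_
        rw [spikeDist_G_castSucc]
        change (1 - ρ) * 0 + ρ * 1 = (ρ : ℝ)
        ring
      · refine (hcl _ _).le.trans ?_
        rw [spikeDist_G_last]
        change (1 - ρ) * ε + ρ * ε ≤ ε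
        linarith
    · refine ⟨1, by norm_num, fun i => ?_, ?_⟩
      · refine (hcl _ _).trans ?_
        rw [spikeDist_G_castSucc]
        change (1 - ρ) * 1 + ρ * 1 = (1 : ℝ)
        ring
      -- The first `N ≥ k + 1` agents all clear and exhaust the slots, so the last agent contributes
      -- nothing, however likely it is to clear.
      · rw [pbLt_const_one, if_neg (by simpa using hk), mul_zero]
        exact h0
  refine ⟨r, hr, ?_, ?_⟩
  · rw [Fin.sum_univ_castSucc, sum_eq_zero, zero_add, Fin.val_last, pbLt_extendZero_congr hcast]
    · rw [spikeDist_G_last]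
      exact mul_le_mul_of_nonneg_right (min_le_right _ _) (pbLt_nonneg (fun _ _ => hr) _)
    · intro i _
      rw [spikeDist_G_castSucc]
      change min _ (0 : ℝ) * _ = 0
      rw [min_eq_right (hτ _).1, zero_mul]
  · have hmin : ∀ i, min ((spikeDist N h0 h1).clearProb J ρ i)
        ((spikeDist N h0 h1).G i (Fin.succ (2 : Fin 3))) = (spikeDist N h0 h1).clearProb J ρ i := by
      intro i
      rw [show (spikeDist N h0 h1).G i (Fin.succ (2 : Fin 3)) = 1 from
        (spikeDist N h0 h1).G_last i]
      exact min_eq_left (hτ i).2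
    simp only [hmin]
    rw [sum_mul_pbLt, pbMin_extendZero_succ, pbMin_extendZero_congr hcast,
      pbLt_extendZero_congr hcast]
    linarith

lemma le_prophQ_spikeDist {k : ℕ} : ε ≤ prophQ (k + 1) (spikeDist N h0 h1) (0 : Fin 3) := by
  have hp : ∀ i, (spikeDist N h0 h1).G i (Fin.succ (0 : Fin 3)) ∈ Set.Icc (0 : ℝ) 1 :=
    fun i => (spikeDist N h0 h1).G_mem i _
  refine le_trans (le_of_eq ?_) (weight_mul_le_bernoulliSumExp hp (fun s => by positivity)
    {Fin.last N})
  have hl : (spikeDist N h0 h1).G (Fin.last N) (Fin.succ (0 : Fin 3)) = ε := by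
    rw [spikeDist_G_last]; rfl
  rw [prod_singleton, hl, prod_eq_one, card_singleton]
  · simp
  · intro i hi
    obtain ⟨i', rfl⟩ := Fin.exists_castSucc_eq.2 (by simpa using hi)
    rw [spikeDist_G_castSucc]
    change (1 : ℝ) - 0 = 1
    ring

end Spike

lemma min_le_prophQ {n : ℕ} (k : ℕ) (D : TypeDist n) {j : Fin D.m} (hj : j.succ = Fin.last D.m) :
    min (n : ℝ) k ≤ prophQ k D j := by
  refine le_trans (le_of_eq ?_) (weight_mul_le_bernoulliSumExp (fun i => D.G_mem i j.succ)
    (fun s => by positivity) univ)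
  simp [hj, D.G_last]

/-- Nonnegativity of `c` replaces integrability: the integral of a non-integrable function is `0` by
convention. -/
lemma integral_le_of_forall_le {T : Type*} [MeasurableSpace T] (μ : Measure T)
    [IsProbabilityMeasure μ] {f : T → ℝ} {c : ℝ} (hc : 0 ≤ c) (h : ∀ t, f t ≤ c) :
    ∫ t, f t ∂μ ≤ c := by
  by_cases hf : Integrable f μ
  · exact (integral_mono hf (integrable_const c) h).trans_eq (by simp)
  · rwa [integral_undef hf]

lemma feasibleST_spikeDist_le {N k : ℕ} (hk : k + 1 ≤ N) {q : ℝ} (hq : q ∈ Set.Icc (0 : ℝ) 1)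
    (hpos : 0 < pbLt (fun _ => q) (range N) (k + 1))
    (hbal : pbMin (fun _ => q) (range N) (k + 1) =
      ((k + 1 : ℕ) : ℝ) * pbLt (fun _ => q) (range N) (k + 1))
    {ε : ℝ} (h0 : 0 < ε) (h1 : ε ≤ 1) {θ : ℝ}
    (h : FeasibleST (k + 1) (spikeDist N h0.le h1) (prophQ (k + 1) (spikeDist N h0.le h1)) θ) :
    θ ≤ pbLt (fun _ => q) (range N) (k + 1) + ε := by
  rcases le_or_gt θ 0 with hθ | hθ
  · linarith
  rw [feasibleST_iff] at h
  obtain ⟨μ, hμ, h⟩ := h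
  have hb := h (0 : Fin 3)
  have hw := h (2 : Fin 3)
  have hb' := mul_le_mul_of_nonneg_left (le_prophQ_spikeDist (N := N) (k := k) h0.le h1) hθ.le
  have hw' : θ * ((k + 1 : ℕ) : ℝ) ≤ _ := mul_le_mul_of_nonneg_left
    ((min_eq_right (by exact_mod_cast (by omega : k + 1 ≤ N + 1))).symm.le.trans
      (min_le_prophQ (k + 1) (spikeDist N h0.le h1) (j := (2 : Fin 3)) rfl)) hθ.le
  have hkpos : (0 : ℝ) < ((k + 1 : ℕ) : ℝ) := by positivity
  replace hb := hb'.trans hb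
  replace hw := hw'.trans hw
  -- A positive integral cannot be the default value `0`, so integrability comes for free.
  have hib := Not.imp_symm integral_undef (hb.trans_lt' (mul_pos hθ h0)).ne'
  have hiw := Not.imp_symm integral_undef (hw.trans_lt' (mul_pos hθ hkpos)).ne'
  set V := pbLt (fun _ => q) (range N) (k + 1) with hV
  set F := pbLt (fun _ => q) (range (N - 1)) (k + 1) with hF
  set a := pb (fun _ => q) (range (N - 1)) k with ha
  have ha0 : 0 ≤ a := pb_nonneg (fun _ _ => hq) _
  have hF0 : 0 < F := hpos.trans_le (pbLt_range_antitone (fun _ => hq) (k + 1) (Nat.sub_le N 1))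
  -- The weights `F` and `ε * a` are the tangent coefficients at `q`, rescaled because the best-type
  -- constraint carries a factor `ε`. The bound then holds pointwise in the threshold.
  have key : F * (θ * ε) + ε * a * (θ * ((k + 1 : ℕ) : ℝ)) ≤
      ε * (F * V + a * (((k + 1 : ℕ) : ℝ) * V) + a * ε) := by
    refine (add_le_add (mul_le_mul_of_nonneg_left hb hF0.le)
      (mul_le_mul_of_nonneg_left hw (mul_nonneg h0.le ha0))).trans ?_
    rw [← integral_const_mul, ← integral_const_mul, ← integral_add (hib.const_mul _)
      (hiw.const_mul _)]
    refine integral_le_of_forall_le μ (by positivity) fun t => ?_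
    obtain ⟨r, hr, hr0, hr2⟩ := spikeDist_coverage_le h0.le h1 hk t.1
      (Set.Ioc_subset_Icc_self t.2.2)
    have htan := pbLt_pbMin_const_le_tangent hk hr hq
    rw [hbal, ← hV, ← hF, ← ha] at htan
    have s1 := mul_le_mul_of_nonneg_left hr0 hF0.le
    have s2 := mul_le_mul_of_nonneg_left hr2 (mul_nonneg h0.le ha0)
    have s3 := mul_le_mul_of_nonneg_left htan h0.le
    refine (add_le_add s1 s2).trans ?_
    linarith
  have hk1 : (1 : ℝ) ≤ ((k + 1 : ℕ) : ℝ) := by exact_mod_cast Nat.succ_pos k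
  have hsum : 0 < F + a * ((k + 1 : ℕ) : ℝ) := by positivity
  have key2 : ε * (θ * (F + a * ((k + 1 : ℕ) : ℝ))) ≤
      ε * ((V + ε) * (F + a * ((k + 1 : ℕ) : ℝ))) := by
    refine le_trans (by linarith) (key.trans (mul_le_mul_of_nonneg_left ?_ h0.le))
    have := mul_nonneg h0.le (add_nonneg hF0.le (mul_nonneg ha0 (sub_nonneg.2 hk1)))
    linarith
  exact le_of_mul_le_mul_right (le_of_mul_le_mul_left key2 h0) hsum

/-! ### At least as many slots as agents, and the common worst-case value -/

/-- The threshold that accepts everyone is used: with `n ≤ k` a slot is always free. -/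
lemma TypeDist.exists_feasibleOST_one {n k : ℕ} (hn : 1 ≤ n) (hnk : n ≤ k) (D : TypeDist n) :
    ∃ (J : Fin D.m) (ρ : Set.Ioc (0 : ℝ) 1), FeasibleOST k D (exAnteQ k D) J ρ 1 := by
  have hm := D.m_pos hn
  refine ⟨⟨D.m - 1, by omega⟩, ⟨1, by norm_num⟩, ?_⟩
  rw [feasibleOST_iff D _ _ (by norm_num)]
  have hlast : Fin.succ (⟨D.m - 1, by omega⟩ : Fin D.m) = Fin.last D.m :=
    Fin.ext (by simp; omega)
  have hτ : D.clearProb ⟨D.m - 1, by omega⟩ 1 = fun _ => 1 := by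
    funext i
    rw [TypeDist.clearProb, hlast, D.G_last]; ring
  intro j
  rw [hτ, one_mul]
  refine (min_le_left _ _).trans (sum_le_sum fun i _ => ?_)
  rw [min_eq_right (D.G_mem i _).2, pbLt_congr (p' := fun _ => 1), pbLt_const_one, if_pos, mul_one]
  · simpa using i.2.trans_le hnk
  · intro l hl
    exact extendZero_val (fun _ : Fin n => (1 : ℝ)) ⟨l, (mem_range.1 hl).trans i.2⟩

lemma feasibleST_le_one {n k : ℕ} (hn : 1 ≤ n) (hnk : n ≤ k) (D : TypeDist n) {θ : ℝ}
    (h : FeasibleST k D (prophQ k D) θ) : θ ≤ 1 := by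
  rcases le_or_gt θ 0 with hθ | hθ
  · linarith
  have hm := D.m_pos hn
  rw [feasibleST_iff] at h
  obtain ⟨μ, hμ, h⟩ := h
  have hQ := min_le_prophQ k D (j := ⟨D.m - 1, by omega⟩) (Fin.ext (by simp; omega))
  rw [min_eq_left (by exact_mod_cast hnk)] at hQ
  have hnpos : (0 : ℝ) < n := by exact_mod_cast hn
  have hle : θ * n ≤ 1 * n := by
    rw [one_mul]
    refine (mul_le_mul_of_nonneg_left hQ hθ.le).trans ((h _).trans
      (integral_le_of_forall_le μ hnpos.le fun t => ?_))
    have hτ := D.clearProb_mem t.1 (Set.Ioc_subset_Icc_self t.2.2)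
    have hp := extendZero_mem hτ
    refine (sum_le_sum (g := fun _ => (1 : ℝ)) fun i _ => ?_).trans_eq (by simp)
    exact mul_le_one₀ ((min_le_left _ _).trans (hτ i).2) (pbLt_nonneg (fun j _ => hp j) _)
      (pbLt_le_one (fun j _ => hp j) _)
  exact le_of_mul_le_mul_right hle hnpos

/-- There is a value that an oblivious static threshold guarantees against the ex-ante relaxation
for all type distributions, and that no distribution of static thresholds can exceed against the
prophet for suitable ones. -/
theorem exists_worstCase_value {n k : ℕ} (hn : 1 ≤ n) (hk : 1 ≤ k) : ∃ V : ℝ,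
    (∀ D : TypeDist n, ∃ (J : Fin D.m) (ρ : Set.Ioc (0 : ℝ) 1),
      FeasibleOST k D (exAnteQ k D) J ρ V) ∧
    ∀ ε : ℝ, 0 < ε → ∃ D : TypeDist n, ∀ θ, FeasibleST k D (prophQ k D) θ → θ ≤ V + ε := by
  obtain ⟨N, rfl⟩ : ∃ N, n = N + 1 := ⟨n - 1, by omega⟩
  obtain ⟨K, rfl⟩ : ∃ K, k = K + 1 := ⟨k - 1, by omega⟩
  rcases le_or_gt N K with hNK | hNK
  · refine ⟨1, fun D => D.exists_feasibleOST_one hn (by omega), fun ε hε =>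
      ⟨spikeDist N zero_le_one le_rfl, fun θ h => ?_⟩⟩
    linarith [feasibleST_le_one hn (by omega) _ h]
  · obtain ⟨q, hq, hpos, hbal⟩ := exists_balanced_const (N := N) (k := K) hNK
    refine ⟨_, fun D => D.exists_feasibleOST hNK hq hbal, fun ε hε =>
      ⟨spikeDist N (lt_min hε one_pos).le (min_le_right ε 1), fun θ h => ?_⟩⟩
    have := feasibleST_spikeDist_le hNK hq hpos hbal (lt_min hε one_pos) (min_le_right ε 1) h
    linarith [min_le_left ε 1]

lemma worstSTProph_le_worstOSTExAnte {n k : ℕ} (hn : 1 ≤ n) (hk : 1 ≤ k) :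
    worstSTProph k n ≤ worstOSTExAnte k n := by
  obtain ⟨V, hlow, hup⟩ := exists_worstCase_value hn hk
  refine le_trans (b := (V : EReal)) ?_ (le_iInf fun D => ?_)
  · refine EReal.le_of_forall_lt_iff_le.1 fun z hz => ?_
    obtain ⟨D, hD⟩ := hup (z - V) (sub_pos.2 (EReal.coe_lt_coe_iff.1 hz))
    exact (iInf_le _ D).trans (iSup₂_le fun θ hθ =>
      EReal.coe_le_coe_iff.2 ((hD θ hθ).trans_eq (by ring)))
  · obtain ⟨J, ρ, h⟩ := hlow D
    exact (le_iSup₂ (f := fun (θ : ℝ) (_ : FeasibleOST k D (exAnteQ k D) J ρ θ) => (θ : EReal))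
      V h).trans (le_iSup₂ (f := fun (J : Fin D.m) (ρ : Set.Ioc (0 : ℝ) 1) =>
        innerLPOST k D (exAnteQ k D) J ρ) J ρ)

end WorstCase

end StaticThreshold

theorem mainTheorem3 (n k : ℕ) (hn : 1 ≤ n) (hk : 1 ≤ k) :
    StaticThreshold.worstSTProph k n = StaticThreshold.worstSTExAnte k n ∧
    StaticThreshold.worstSTExAnte k n = StaticThreshold.worstOSTProph k n ∧
    StaticThreshold.worstOSTProph k n = StaticThreshold.worstOSTExAnte k n := by
  have h := StaticThreshold.worstSTProph_le_worstOSTExAnte hn hk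
  have h1 : StaticThreshold.worstOSTExAnte k n ≤ StaticThreshold.worstOSTProph k n :=
    iInf_mono fun D => iSup₂_mono fun J ρ => StaticThreshold.innerLPOST_exAnteQ_le D J ρ
  have h2 : StaticThreshold.worstOSTProph k n ≤ StaticThreshold.worstSTProph k n :=
    iInf_mono fun D => StaticThreshold.iSup_innerLPOST_le_innerLPST D _
  have h3 : StaticThreshold.worstOSTExAnte k n ≤ StaticThreshold.worstSTExAnte k n :=
    iInf_mono fun D => StaticThreshold.iSup_innerLPOST_le_innerLPST D _
  have h4 : StaticThreshold.worstSTExAnte k n ≤ StaticThreshold.worstSTProph k n :=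
    iInf_mono fun D => StaticThreshold.innerLPST_exAnteQ_le D
  have e1 := le_antisymm (h.trans h3) h4
  have e2 := le_antisymm h1 (h2.trans h)
  exact ⟨e1, le_antisymm (h4.trans (h.trans h1)) (h2.trans (h.trans h3)), e2.symm⟩
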